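/- Let $\mathbb B_3$ be the blow-up of $\mathbb P^2_{\mathbb C}$ at three non-collinear points, with exceptional curves $E_1,E_2,E_3$, let $H$ be the strict transform of a line missing the three points, and let $L_1$ be the strict transform of the line through the points under $E_2$ and $E_3$, so that $L_1\sim H-E_2-E_3$. Explicitly, $\mathbb B_3=(\mathbb C^6\setminus W)/(\mathbb C^\times)^4$, where $(\mathbb C^\times)^4$ acts on the coordinates $X,Y,Z,s,t,u$ of $\mathbb C^6$ with weights $(1,1,0,1)$, $(1,0,1,1)$, $(1,1,1,0)$, $(0,-1,0,0)$, $(0,0,-1,0)$, $(0,0,0,-1)$, and $W$ is the union of the nine subspaces $X=t=0$, $Y=s=0$, $Z=u=0$, $X=Y=0$, $Y=Z=0$, $Z=X=0$, $s=t=0$, $u=t=0$, $s=u=0$; here $L_1=\{X=0\}$, $E_1=\{t=0\}$, $E_2=\{s=0\}$, $E_3=\{u=0\}$, and the blow-down to $\mathbb P^2$ is $(Xsu,Ytu,Zst)$. Identify $\operatorname{Pic}\mathbb B_3$ with $\mathbb Z^4$ by the ordered basis $H,-E_2,-E_1,-E_3$, and let $\theta:\mathbb Z^4\to\mathbb Z^4$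 be left multiplication by $$\begin{pmatrix}2&-1&-1&-1\\1&-1&-1&0\\1&0&-1&-1\\1&-1&0&-1\end{pmatrix}.$$ Let $D_0=0$, let $D_1=(1,1,0,1)$ be the class of $L_1$, and let $D_n=(1+\theta+\cdots+\theta^{n-1})(D_1)$ for $n\ge1$. Write $h^0(D)=\dim_{\mathbb C}H^0(\mathbb B_3,\mathcal O(D))$. Then for all integers $m\ge 0$ and $0\le r\le 5$, $$h^0(D_{6m+r})=\begin{cases}(m+1)(3m+r)&\text{if } r\ne0,\\ 3m^2+3m+1&\text{if } r=0,\end{cases}$$ and, as formal power series, $$\sum_{n=0}^\infty h^0(D_n)\,t^n=\frac1{(1-t)(1-t^2)(1-t^3)}.$$ -/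

import Mathlib

/-! The third del Pezzo surface over `ℂ`, presented as the orbit space `(ℂ⁶ - W) / (ℂˣ)⁴`, with its
Zariski topology, its regular functions, its divisors and the spaces `H⁰(O(D))`. -/

namespace DelPezzo

/-- Polynomials in the six coordinates `X, Y, Z, s, t, u`, numbered `0, 1, 2, 3, 4, 5`. -/
abbrev Poly : Type := MvPolynomial (Fin 6) ℂ

/-- The weights of the action of `(ℂˣ)⁴` on the coordinates `X, Y, Z, s, t, u`. -/
def weight : Fin 6 → Fin 4 → ℤ :=
  ![![1, 1, 0, 1], ![1, 0, 1, 1], ![1, 1, 1, 0],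
    ![0, -1, 0, 0], ![0, 0, -1, 0], ![0, 0, 0, -1]]

/-- The pairs of coordinates whose common zero loci make up the irrelevant locus: `Xt`, `Ys`, `Zu`;
`XY`, `YZ`, `ZX`; `st`, `ut`, `su`. -/
def irrelevantPairs : Finset (Fin 6 × Fin 6) :=
  {(0, 4), (1, 3), (2, 5), (0, 1), (1, 2), (2, 0), (3, 4), (5, 4), (3, 5)}

/-- The irrelevant locus `W`, a union of nine subspaces of codimension two. -/
def irrelevantLocus : Set (Fin 6 → ℂ) :=
  {p | ∃ ij ∈ irrelevantPairs, p ij.1 = 0 ∧ p ij.2 = 0}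

/-- The points of `ℂ⁶ - W`. -/
structure Pt where
  coord : Fin 6 → ℂ
  not_mem : coord ∉ irrelevantLocus

/-- The torus `(ℂˣ)⁴`. -/
abbrev Torus : Type := Fin 4 → ℂˣ

/-- The character of the torus given by the exponent vector `w`. -/
def character (w : Fin 4 → ℤ) (g : Torus) : ℂˣ := ∏ j, g j ^ w j

theorem character_one (w : Fin 4 → ℤ) : character w 1 = 1 := by
  simp [character]

theorem character_mul (w : Fin 4 → ℤ) (g h : Torus) :
    character w (g * h) = character w g * character w h := by
  simp [character, mul_zpow, Finset.prod_mul_distrib]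

instance : MulAction Torus Pt where
  smul g p := ⟨fun i => character (weight i) g * p.coord i, by
    rintro ⟨ij, hij, h1, h2⟩
    exact p.not_mem ⟨ij, hij, by simpa using h1, by simpa using h2⟩⟩
  one_smul p := by
    cases p
    simp [HSMul.hSMul, character_one]
  mul_smul g h p := by
    cases p
    simp [HSMul.hSMul, character_mul, mul_assoc]

/-- The Zariski topology of `ℂ⁶ - W`. -/
instance : TopologicalSpace Pt :=
  TopologicalSpace.generateFrom
    {U | ∃ F : Poly, U = {p : Pt | MvPolynomial.eval p.coord F ≠ 0}}

/-- The surface `𝔹₃`, the orbit space of `ℂ⁶ - W` under the torus. -/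
def B3 : Type := MulAction.orbitRel.Quotient Torus Pt

/-- The quotient map `ℂ⁶ - W → 𝔹₃`. -/
def proj (p : Pt) : B3 := Quotient.mk (MulAction.orbitRel Torus Pt) p

/-- The Zariski topology of `𝔹₃` is the quotient topology. -/
instance : TopologicalSpace B3 := TopologicalSpace.coinduced proj inferInstance

/-- The function `f` is regular on the open subset `V` of `𝔹₃`: its pullback to `ℂ⁶ - W` is, near
each point over `V`, a quotient of polynomials. The values of `f` outside `V` play no role. -/
def IsRegularOn (V : Set B3) (f : B3 → ℂ) : Prop :=
  ∀ p : Pt, proj p ∈ V → ∃ F G : Poly, MvPolynomial.eval p.coord G ≠ 0 ∧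
    ∀ q : Pt, proj q ∈ V → MvPolynomial.eval q.coord G ≠ 0 →
      f (proj q) = MvPolynomial.eval q.coord F / MvPolynomial.eval q.coord G

/-- Seven curves on `𝔹₃`: the exceptional curves `E₁, E₂, E₃`, the strict transforms `L₁, L₂, L₃` of
the lines through two of the points blown up, and the strict transform `H` of a line that misses
these points. -/
inductive Curve where
  | H | E1 | E2 | E3 | L1 | L2 | L3
  deriving DecidableEq

instance : Fintype Curve where
  elems := {.H, .E1, .E2, .E3, .L1, .L2, .L3}
  complete C := by cases C <;> decide

open MvPolynomial in
/-- The equations of the curves. In the coordinates `Xsu, Ytu, Zst` of the plane, `H` is the strict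
transform of the line on which the sum of the coordinates vanishes. -/
noncomputable def Curve.equation : Curve → Poly
  | .H => X 0 * X 3 * X 5 + X 1 * X 4 * X 5 + X 2 * X 3 * X 4
  | .E1 => X 4
  | .E2 => X 3
  | .E3 => X 5
  | .L1 => X 0
  | .L2 => X 1
  | .L3 => X 2

/-- A curve as a subset of `𝔹₃`. -/
def Curve.carrier (C : Curve) : Set B3 :=
  {x | ∃ p : Pt, proj p = x ∧ MvPolynomial.eval p.coord C.equation = 0}

/-- The class of a curve in `Pic 𝔹₃ = ℤ⁴`, in the basis `H, -E₂, -E₁, -E₃`. Here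
`L₁ = H - E₂ - E₃`, `L₂ = H - E₁ - E₃` and `L₃ = H - E₁ - E₂`. -/
def Curve.cls : Curve → Fin 4 → ℤ
  | .H => ![1, 0, 0, 0]
  | .E1 => ![0, 0, -1, 0]
  | .E2 => ![0, -1, 0, 0]
  | .E3 => ![0, 0, 0, -1]
  | .L1 => ![1, 1, 0, 1]
  | .L2 => ![1, 0, 1, 1]
  | .L3 => ![1, 1, 1, 0]

/-- The function `g` is a local equation of the curve `C` on the open set `V`: it is regular on `V`,
and at each point of `V` its germ generates the ideal of germs of regular functions that vanish
on `C`. -/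
def IsLocalEquation (V : Set B3) (C : Curve) (g : B3 → ℂ) : Prop :=
  IsRegularOn V g ∧ (∀ x ∈ V ∩ C.carrier, g x = 0) ∧
    ∀ x ∈ V, ∀ V' : Set B3, IsOpen V' → x ∈ V' → ∀ f : B3 → ℂ, IsRegularOn V' f →
      (∀ y ∈ V' ∩ C.carrier, f y = 0) →
      ∃ V'' : Set B3, IsOpen V'' ∧ x ∈ V'' ∧ V'' ⊆ V ∩ V' ∧
        ∃ k : B3 → ℂ, IsRegularOn V'' k ∧ ∀ y ∈ V'', f y = g y * k y

/-- Divisors supported on the seven curves. -/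
abbrev Divisor : Type := Curve → ℤ

/-- The class of a divisor in `Pic 𝔹₃ = ℤ⁴`. -/
def Divisor.cls (D : Divisor) : Fin 4 → ℤ := ∑ C, D C • C.cls

/-- The dense open complement of the seven curves. -/
def offCurves : Set B3 := {x | ∀ C : Curve, x ∉ C.carrier}

theorem IsRegularOn.zero (V : Set B3) : IsRegularOn V 0 :=
  fun _ _ => ⟨0, 1, by simp, by simp⟩

theorem IsRegularOn.smul {V : Set B3} {f : B3 → ℂ} (c : ℂ) (hf : IsRegularOn V f) :
    IsRegularOn V (c • f) := by
  intro p hp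
  obtain ⟨F, G, hG, h⟩ := hf p hp
  refine ⟨MvPolynomial.C c * F, G, hG, fun q hq hGq => ?_⟩
  simp [h q hq hGq, mul_div_assoc]

theorem IsRegularOn.add {V : Set B3} {f g : B3 → ℂ} (hf : IsRegularOn V f)
    (hg : IsRegularOn V g) : IsRegularOn V (f + g) := by
  intro p hp
  obtain ⟨F, G, hG, h⟩ := hf p hp
  obtain ⟨F', G', hG', h'⟩ := hg p hp
  refine ⟨F * G' + G * F', G * G', by simp [hG, hG'], fun q hq hGq => ?_⟩
  simp only [map_mul, ne_eq, mul_eq_zero, not_or] at hGq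
  simp only [Pi.add_apply, h q hq hGq.1, h' q hq hGq.2, map_add, map_mul]
  exact div_add_div _ _ hGq.1 hGq.2

theorem IsRegularOn.mono {V V' : Set B3} {f : B3 → ℂ} (hf : IsRegularOn V f) (hV : V' ⊆ V) :
    IsRegularOn V' f := by
  intro p hp
  obtain ⟨F, G, hG, h⟩ := hf p (hV hp)
  exact ⟨F, G, hG, fun q hq => h q (hV hq)⟩

/-- `H⁰(𝔹₃, O(D))`: the rational functions `f` such that `f · ∏ g_C ^ D(C)` is regular on `V`
whenever the `g_C` are local equations of the curves on `V`. Such an `f` is regular off the curves;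
it is represented by its values there, extended by `0`. -/
def sections (D : Divisor) : Submodule ℂ (B3 → ℂ) where
  carrier := {f | (∀ x ∉ offCurves, f x = 0) ∧ IsRegularOn offCurves f ∧
    ∀ (V : Set B3) (g : Curve → B3 → ℂ), IsOpen V → (∀ C, IsLocalEquation V C (g C)) →
      ∀ x ∈ V, ∃ V' : Set B3, IsOpen V' ∧ x ∈ V' ∧ V' ⊆ V ∧
        ∃ k : B3 → ℂ, IsRegularOn V' k ∧
          ∀ y ∈ V' ∩ offCurves, k y = f y * ∏ C, g C y ^ D C}
  zero_mem' := by
    refine ⟨fun _ _ => rfl, .zero _, fun V g hV _ x hx => ⟨V, hV, hx, subset_rfl, 0, .zero _, ?_⟩⟩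
    simp
  add_mem' := by
    rintro a b ⟨ha0, ha1, ha⟩ ⟨hb0, hb1, hb⟩
    refine ⟨fun x hx => by simp [ha0 x hx, hb0 x hx], ha1.add hb1, fun V g hV hg x hx => ?_⟩
    obtain ⟨A, hA, hxA, hAV, k, hk, hka⟩ := ha V g hV hg x hx
    obtain ⟨B, hB, hxB, hBV, l, hl, hlb⟩ := hb V g hV hg x hx
    refine ⟨A ∩ B, hA.inter hB, ⟨hxA, hxB⟩, Set.inter_subset_left.trans hAV, k + l,
      (hk.mono Set.inter_subset_left).add (hl.mono Set.inter_subset_right), ?_⟩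
    rintro y ⟨⟨hyA, hyB⟩, hy⟩
    simp only [Pi.add_apply, hka y ⟨hyA, hy⟩, hlb y ⟨hyB, hy⟩, add_mul]
  smul_mem' := by
    rintro c a ⟨ha0, ha1, ha⟩
    refine ⟨fun x hx => by simp [ha0 x hx], ha1.smul c, fun V g hV hg x hx => ?_⟩
    obtain ⟨A, hA, hxA, hAV, k, hk, hka⟩ := ha V g hV hg x hx
    refine ⟨A, hA, hxA, hAV, c • k, hk.smul c, fun y hy => ?_⟩
    simp only [Pi.smul_apply, smul_eq_mul, hka y hy, mul_assoc]

/-- `h⁰(D) = dim H⁰(𝔹₃, O(D))`. -/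
noncomputable def h0 (D : Divisor) : ℕ := Module.finrank ℂ (sections D)

/-- The action on `Pic 𝔹₃ = ℤ⁴` of the automorphism of order six. -/
def theta : Matrix (Fin 4) (Fin 4) ℤ :=
  !![2, -1, -1, -1; 1, -1, -1, 0; 1, 0, -1, -1; 1, -1, 0, -1]

/-- The class `D_n = (1 + θ + ⋯ + θ ^ (n - 1)) D₁`, where `D₁` is the class of the line `L₁`. -/
def classD (n : ℕ) : Fin 4 → ℤ := (∑ i ∈ Finset.range n, theta ^ i).mulVec Curve.L1.cls

end DelPezzo

namespace DelPezzo

/-!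
The surface `𝔹₃` is the quotient of an open subset of `ℂ⁶` whose complement has codimension two, and
`ℂ[X, Y, Z, s, t, u]` is factorial. Hence a regular function on an open set of `𝔹₃` is a single
reduced fraction `A / B`. Its invariance under the torus forces `A` and `B` to be homogeneous of the
same weight. Multiplying a section of `O(D)` by the equation of `D` gives a reduced fraction whose
denominator can vanish only on the irrelevant locus and is therefore constant. In this way
`H⁰(O(D))` becomes the part of weight `D.cls` of `ℂ[X, Y, Z, s, t, u]`, and `h⁰(D)` counts its
monomials.

For the class `(a, b₀, b₁, b₂)` these monomials are the lattice points of a triangle of size `a`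
from which three corners of sizes `b₀`, `b₁`, `b₂` have been removed. The corners are disjoint for
the classes `D_n`, so `h⁰` is quadratic in the class. Since `θ ^ 6 = 1`, the sequence `D_n`
increases by `(3, 1, 1, 1)` every six steps, and the six formulas follow. They give
`h⁰(D_{n + 3}) - h⁰(D_n) = ⌊(n + 3) / 2⌋ + 1`, which is the coefficient of `t ^ (n + 3)` in
`1 / ((1 - t) (1 - t ^ 2))`.
-/

section CoxRing

open MvPolynomial

section Polynomials

variable {σ K M : Type*} [Field K] [AddCommGroup M]

theorem dvd_of_forall_eval_eq_zero [IsAlgClosed K] [Finite σ] {P F : MvPolynomial σ K}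
    (hP : Prime P) (h : ∀ x, eval x P = 0 → eval x F = 0) : P ∣ F := by
  have hprime : (Ideal.span {P}).IsPrime := (Ideal.span_singleton_prime hP.ne_zero).2 hP
  have hF : F ∈ vanishingIdeal K (zeroLocus K (Ideal.span {P})) := fun x hx => by
    rw [zeroLocus_span] at hx
    simpa [aeval_eq_eval] using h x (by simpa [aeval_eq_eval] using hx)
  rwa [vanishingIdeal_zeroLocus_eq_radical, hprime.radical, Ideal.mem_span_singleton] at hF

/-- A prime factor of `B` would divide the product of all variables, hence be one of them; but a
coordinate hyperplane contains points with a single vanishing coordinate. -/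
theorem isUnit_of_forall_exists_pair_eq_zero [IsAlgClosed K] [Finite σ] {B : MvPolynomial σ K}
    (h : ∀ x, eval x B = 0 → ∃ i j, i ≠ j ∧ x i = 0 ∧ x j = 0) : IsUnit B := by
  classical
  have := Fintype.ofFinite σ
  by_contra hB
  have hB0 : B ≠ 0 := by
    rintro rfl
    simpa using h 1 (map_zero _)
  obtain ⟨P, hirr, hPB⟩ := WfDvdMonoid.exists_irreducible_factor hB hB0
  have hP : ∀ x, eval x P = 0 → ∃ i j, i ≠ j ∧ x i = 0 ∧ x j = 0 := fun x hx =>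
    h x (zero_dvd_iff.1 (hx ▸ map_dvd (eval x) hPB))
  have hdvd : P ∣ ∏ i, X i := dvd_of_forall_eval_eq_zero hirr.prime fun x hx => by
    obtain ⟨i, -, -, hi, -⟩ := hP x hx
    rw [map_prod]
    exact Finset.prod_eq_zero (Finset.mem_univ i) (by rwa [eval_X])
  obtain ⟨n, -, hn⟩ := hirr.prime.exists_mem_finset_dvd hdvd
  have hvan : eval (Function.update 1 n 0) P = 0 := zero_dvd_iff.1 <| by
    simpa using map_dvd (eval (Function.update (1 : σ → K) n 0))
      (hirr.dvd_symm X_prime.irreducible hn)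
  obtain ⟨i, j, hij, hi, hj⟩ := hP _ hvan
  simp only [Function.update_apply, Pi.one_apply, ite_eq_left_iff, one_ne_zero, imp_false,
    not_not] at hi hj
  exact hij (hi.trans hj.symm)

/-- A family of points of affine space is Zariski dense when only the zero polynomial vanishes on
all of it. -/
def IsZariskiDense {ι R : Type*} [CommSemiring R] (x : ι → σ → R) : Prop :=
  ∀ F : MvPolynomial σ R, (∀ p, eval (x p) F = 0) → F = 0

theorem IsZariskiDense.eq_of_eval_eq {ι R : Type*} [CommRing R] [IsDomain R] {x : ι → σ → R}
    (hx : IsZariskiDense x) {N F G : MvPolynomial σ R} (hN : N ≠ 0)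
    (h : ∀ p, eval (x p) N ≠ 0 → eval (x p) F = eval (x p) G) : F = G := by
  refine sub_eq_zero.1 ((mul_eq_zero.1 (hx ((F - G) * N) fun p => ?_)).resolve_right hN)
  rw [map_mul, map_sub, mul_eq_zero, sub_eq_zero, or_iff_not_imp_right]
  exact h p

theorem ne_zero_of_eval_ne_zero {R : Type*} [CommSemiring R] {x : σ → R} {F : MvPolynomial σ R}
    (h : eval x F ≠ 0) : F ≠ 0 :=
  ne_of_apply_ne (eval x) (by rwa [map_zero])

/-- In a factorial ring the local fractions have a common reduced form. -/
theorem IsZariskiDense.exists_isRelPrime_fraction {ι : Type*} {x : ι → σ → K}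
    (hx : IsZariskiDense x) (S : Set ι) (φ : ι → K) {T : MvPolynomial σ K} (hT : T ≠ 0)
    (h : ∀ p ∈ S, ∃ F G : MvPolynomial σ K, eval (x p) G ≠ 0 ∧ ∀ q, eval (x q) G ≠ 0 →
      eval (x q) T ≠ 0 → φ q = eval (x q) F / eval (x q) G) :
    ∃ A B : MvPolynomial σ K, IsRelPrime A B ∧ ∀ p ∈ S, eval (x p) B ≠ 0 ∧
      (eval (x p) T ≠ 0 → φ p = eval (x p) A / eval (x p) B) := by
  rcases S.eq_empty_or_nonempty with rfl | ⟨p₀, hp₀⟩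
  · exact ⟨1, 1, isRelPrime_one_left, by simp⟩
  obtain ⟨F₀, G₀, hG₀, h₀⟩ := h p₀ hp₀
  have hG₀' := ne_zero_of_eval_ne_zero hG₀
  obtain ⟨B, A, D, hrel, rfl, rfl⟩ := UniqueFactorizationMonoid.exists_reduced_factors G₀ hG₀' F₀
  refine ⟨A, B, hrel.symm, fun p hp => ?_⟩
  obtain ⟨F, G, hG, hFG⟩ := h p hp
  have hcross : A * G = F * B := by
    refine hx.eq_of_eval_eq (N := T * (D * B * G))
      (mul_ne_zero hT (mul_ne_zero hG₀' (ne_zero_of_eval_ne_zero hG))) fun q hq => ?_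
    simp only [map_mul, mul_ne_zero_iff] at hq
    obtain ⟨hqT, ⟨hqD, hqB⟩, hqG⟩ := hq
    have heq := (h₀ q (by simp [hqD, hqB]) hqT).symm.trans (hFG q hqG hqT)
    rw [map_mul, map_mul, mul_div_mul_left _ _ hqD, div_eq_div_iff hqB hqG] at heq
    rwa [map_mul, map_mul]
  have hB : eval (x p) B ≠ 0 := fun hB0 => hG <| zero_dvd_iff.1 <| hB0 ▸
    map_dvd (eval (x p)) (hrel.dvd_of_dvd_mul_left (hcross ▸ dvd_mul_left B F))
  refine ⟨hB, fun hpT => ?_⟩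
  rw [hFG p hG hpT, div_eq_div_iff hG hB, ← map_mul, ← map_mul, hcross]

theorem zpow_eq_pow_div_pow {G : Type*} [DivisionMonoid G] (z : G) (n : ℤ) :
    z ^ n = z ^ n.toNat / z ^ (-n).toNat := by
  rcases le_total 0 n with h | h
  · lift n to ℕ using h
    simp
  · obtain ⟨k, rfl⟩ : ∃ k : ℕ, n = -k := ⟨n.natAbs, by omega⟩
    simp

theorem exists_fraction_eq_prod_zpow {ι : Type*} [Fintype ι] {w : σ → M}
    {A B : ι → MvPolynomial σ K} {u v : ι → M}
    (hA : ∀ i, IsWeightedHomogeneous w (A i) (u i))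
    (hB : ∀ i, IsWeightedHomogeneous w (B i) (v i + u i)) (n : ι → ℤ) :
    ∃ (P Q : MvPolynomial σ K) (m : M),
      IsWeightedHomogeneous w P m ∧ IsWeightedHomogeneous w Q (∑ i, n i • v i + m) ∧
      ∀ x, (∀ i, eval x (A i) ≠ 0 ∧ eval x (B i) ≠ 0) → eval x P ≠ 0 ∧ eval x Q ≠ 0 ∧
        ∏ i, (eval x (A i) / eval x (B i)) ^ n i = eval x P / eval x Q := by
  refine ⟨∏ i, A i ^ (n i).toNat * B i ^ (-n i).toNat, ∏ i, A i ^ (-n i).toNat * B i ^ (n i).toNat,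
    ∑ i, ((n i).toNat • u i + (-n i).toNat • (v i + u i)),
    .prod _ _ _ fun i _ => ((hA i).pow _).mul ((hB i).pow _), ?_, fun x hx => ?_⟩
  · rw [← Finset.sum_add_distrib]
    refine .prod _ _ _ fun i _ => ?_
    convert ((hA i).pow (-n i).toNat).mul ((hB i).pow (n i).toNat) using 1
    nth_rw 1 [show n i = (n i).toNat - (-n i).toNat by omega]
    simp only [sub_smul, natCast_zsmul, smul_add]
    abel
  · simp only [map_prod, map_mul, map_pow, Finset.prod_ne_zero_iff, ← Finset.prod_div_distrib]
    refine ⟨fun i _ => mul_ne_zero (pow_ne_zero _ (hx i).1) (pow_ne_zero _ (hx i).2),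
      fun i _ => mul_ne_zero (pow_ne_zero _ (hx i).1) (pow_ne_zero _ (hx i).2),
      Finset.prod_congr rfl fun i _ => ?_⟩
    rw [zpow_eq_pow_div_pow, div_pow, div_pow, div_div_div_eq, mul_comm (eval x (B i) ^ _)]

end Polynomials

section Rescale

variable {σ R : Type*}

/-- The substitution `xᵢ ↦ cᵢ xᵢ`, that is, the pullback of polynomials under the diagonal map `c`
of affine space. -/
noncomputable def rescale [CommSemiring R] (c : σ → R) : MvPolynomial σ R →ₐ[R] MvPolynomial σ R :=
  aeval fun i => C (c i) * X i

theorem eval_rescale [CommSemiring R] (c x : σ → R) (F : MvPolynomial σ R) :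
    eval x (rescale c F) = eval (c * x) F := by
  induction F using MvPolynomial.induction_on with
  | C a => simp [rescale]
  | add F G hF hG => simp [hF, hG]
  | mul_X F i hF => rw [map_mul, map_mul, hF]; simp [rescale]

theorem rescale_monomial [CommSemiring R] (c : σ → R) (d : σ →₀ ℕ) (a : R) :
    rescale c (monomial d a) = monomial d ((d.prod fun i n => c i ^ n) * a) := by
  rw [rescale, aeval_monomial, mul_comm _ a, ← C_mul_monomial, monomial_eq]
  simp only [mul_pow, Finset.prod_mul_distrib, algebraMap_eq, Finsupp.prod, map_prod, map_pow]

theorem coeff_rescale [CommSemiring R] (c : σ → R) (F : MvPolynomial σ R) (d : σ →₀ ℕ) :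
    coeff d (rescale c F) = (d.prod fun i n => c i ^ n) * coeff d F := by
  classical
  induction F using MvPolynomial.induction_on' with
  | add F G hF hG => simp [hF, hG, mul_add]
  | monomial e a =>
    rw [rescale_monomial, coeff_monomial, coeff_monomial]
    split_ifs with h
    · rw [h]
    · rw [mul_zero]

theorem exists_rescale_eq_C_mul_of_dvd [CommRing R] [IsDomain R] {c : σ → R}
    {F : MvPolynomial σ R} (h : F ∣ rescale c F) : ∃ a, rescale c F = C a * F := by
  obtain ⟨Q, hQ⟩ := h
  by_cases hne : rescale c F = 0
  · exact ⟨0, by simp [hne]⟩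
  rw [hQ, ← ne_eq, mul_ne_zero_iff] at hne
  have hsupp : (rescale c F).support ⊆ F.support := fun d hd => by
    rw [mem_support_iff, coeff_rescale] at hd
    exact mem_support_iff.2 (right_ne_zero_of_mul hd)
  have hdeg := totalDegree_le_of_support_subset hsupp
  rw [hQ, totalDegree_mul_of_isDomain hne.1 hne.2] at hdeg
  have hQC := totalDegree_eq_zero_iff_eq_C.1 (show Q.totalDegree = 0 by omega)
  exact ⟨coeff 0 Q, by rw [hQ, ← hQC, mul_comm]⟩

end Rescale

section Torus

/-- The diagonal entries of the linear automorphism of `ℂ⁶` by which `g` acts. -/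
noncomputable abbrev diagonal (g : Torus) : Fin 6 → ℂ := fun i => (character (weight i) g : ℂ)

theorem coord_smul (g : Torus) (p : Pt) : (g • p).coord = diagonal g * p.coord := rfl

theorem proj_smul (g : Torus) (p : Pt) : proj (g • p) = proj p :=
  Quotient.sound ⟨g, rfl⟩

theorem proj_surjective : Function.Surjective proj := Quotient.mk_surjective

theorem exists_smul_of_proj_eq {p q : Pt} (h : proj p = proj q) : ∃ g : Torus, p = g • q := by
  obtain ⟨g, hg⟩ := Quotient.exact h
  exact ⟨g, hg.symm⟩

theorem character_add (v w : Fin 4 → ℤ) (g : Torus) :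
    character (v + w) g = character v g * character w g := by
  simp [character, zpow_add, Finset.prod_mul_distrib]

theorem character_sum {ι : Type*} [Fintype ι] (n : ι → ℤ) (w : ι → Fin 4 → ℤ) (g : Torus) :
    character (∑ i, n i • w i) g = ∏ i, character (w i) g ^ n i := by
  let χ : (Fin 4 → ℤ) →+ Additive ℂˣ :=
    AddMonoidHom.mk' (fun v => .ofMul (character v g)) fun v w => character_add v w g
  change χ (∑ i, n i • w i) = ∑ i, n i • χ (w i)
  simp only [map_sum, map_zsmul]

theorem character_injective : Function.Injective character := fun w w' h => by
  funext j
  have hval (v : Fin 4 → ℤ) : character v (Function.update 1 j (Units.mk0 2 two_ne_zero)) =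
      Units.mk0 2 two_ne_zero ^ v j := by
    rw [character, Finset.prod_eq_single j (fun i _ hi => by simp [Function.update_of_ne hi])
      (by simp), Function.update_self]
  have hpow := (hval w).symm.trans ((congrFun h _).trans (hval w'))
  have hnorm : (2 : ℝ) ^ w j = 2 ^ w' j := by
    simpa using congrArg (fun z : ℂˣ => ‖(z : ℂ)‖) hpow
  exact zpow_right_injective₀ two_pos (by norm_num) hnorm

theorem coeff_rescale_diagonal (g : Torus) (F : Poly) (d : Fin 6 →₀ ℕ) :
    coeff d (rescale (diagonal g) F) = character (Finsupp.weight weight d) g * coeff d F := by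
  have hd : Finsupp.weight weight d = ∑ i, (d i : ℤ) • weight i := by
    simp [Finsupp.weight_apply, Finsupp.sum_fintype]
  rw [coeff_rescale, hd, character_sum, Finsupp.prod_fintype _ _ (by simp)]
  simp [diagonal]

theorem isWeightedHomogeneous_iff_rescale {F : Poly} {w : Fin 4 → ℤ} :
    IsWeightedHomogeneous weight F w ↔
      ∀ g, rescale (diagonal g) F = C (character w g : ℂ) * F := by
  refine ⟨fun h g => ?_, fun h d hd => character_injective (funext fun g => ?_)⟩
  · ext d
    rw [coeff_rescale_diagonal, coeff_C_mul]
    by_cases hd : coeff d F = 0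
    · simp [hd]
    · rw [h hd]
  · have hcoeff := congrArg (coeff d) (h g)
    rw [coeff_rescale_diagonal, coeff_C_mul] at hcoeff
    exact Units.ext (mul_right_cancel₀ hd hcoeff)

theorem eval_smul {F : Poly} {w : Fin 4 → ℤ} (h : IsWeightedHomogeneous weight F w) (g : Torus)
    (p : Pt) : eval (g • p).coord F = character w g * eval p.coord F := by
  rw [coord_smul, ← eval_rescale, isWeightedHomogeneous_iff_rescale.1 h g, map_mul, eval_C]

theorem exists_isWeightedHomogeneous_of_dvd_rescale {F : Poly}
    (h : ∀ g, F ∣ rescale (diagonal g) F) : ∃ w, IsWeightedHomogeneous weight F w := by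
  rcases eq_or_ne F 0 with rfl | hF
  · exact ⟨0, isWeightedHomogeneous_zero ℂ weight 0⟩
  obtain ⟨d, hd⟩ := ne_zero_iff.1 hF
  refine ⟨Finsupp.weight weight d, isWeightedHomogeneous_iff_rescale.2 fun g => ?_⟩
  obtain ⟨a, ha⟩ := exists_rescale_eq_C_mul_of_dvd (h g)
  have hcoeff := congrArg (coeff d) ha
  rw [coeff_rescale_diagonal, coeff_C_mul] at hcoeff
  rw [ha, mul_right_cancel₀ hd hcoeff]

theorem isWeightedHomogeneous_of_mul_left {F G : Poly} {v w : Fin 4 → ℤ} (hF : F ≠ 0)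
    (h : IsWeightedHomogeneous weight F v) (hFG : IsWeightedHomogeneous weight (F * G) (v + w)) :
    IsWeightedHomogeneous weight G w := by
  refine isWeightedHomogeneous_iff_rescale.2 fun g => ?_
  have hne : rescale (diagonal g) F ≠ 0 := by
    rw [isWeightedHomogeneous_iff_rescale.1 h g]
    exact mul_ne_zero (C_ne_zero.2 (Units.ne_zero _)) hF
  refine mul_left_cancel₀ hne ?_
  rw [← map_mul, isWeightedHomogeneous_iff_rescale.1 hFG, isWeightedHomogeneous_iff_rescale.1 h,
    character_add, Units.val_mul, C_mul]
  ring

end Torus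

section Topology

theorem isZariskiDense_coord : IsZariskiDense Pt.coord := fun F hF => by
  have hX : (∏ i : Fin 6, X i : Poly) ≠ 0 := Finset.prod_ne_zero_iff.2 fun i _ => X_ne_zero i
  refine (mul_eq_zero.1 (MvPolynomial.funext fun x => ?_)).resolve_right hX
  rw [map_zero, map_mul, mul_eq_zero, or_iff_not_imp_right, map_prod, Finset.prod_eq_zero_iff]
  intro hx
  refine hF ⟨x, ?_⟩
  rintro ⟨ij, -, hi, -⟩
  exact hx ⟨ij.1, Finset.mem_univ _, by rwa [eval_X]⟩

theorem exists_eval_ne_zero_subset {U : Set Pt} (hU : IsOpen U) :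
    ∀ p ∈ U, ∃ N : Poly, eval p.coord N ≠ 0 ∧ ∀ q : Pt, eval q.coord N ≠ 0 → q ∈ U := by
  induction hU with
  | basic s hs =>
    obtain ⟨F, rfl⟩ := hs
    exact fun p hp => ⟨F, hp, fun q hq => hq⟩
  | univ => exact fun p _ => ⟨1, by simp, fun q _ => trivial⟩
  | inter s t _ _ ihs iht =>
    rintro p ⟨hps, hpt⟩
    obtain ⟨M, hM, hMs⟩ := ihs p hps
    obtain ⟨N, hN, hNt⟩ := iht p hpt
    refine ⟨M * N, by simp [hM, hN], fun q hq => ?_⟩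
    rw [map_mul, mul_ne_zero_iff] at hq
    exact ⟨hMs q hq.1, hNt q hq.2⟩
  | sUnion S _ ih =>
    rintro p ⟨s, hs, hp⟩
    obtain ⟨N, hN, hNs⟩ := ih s hs p hp
    exact ⟨N, hN, fun q hq => ⟨s, hs, hNs q hq⟩⟩

theorem exists_eval_ne_zero_subset_proj {V : Set B3} (hV : IsOpen V) {p : Pt} (hp : proj p ∈ V) :
    ∃ N : Poly, eval p.coord N ≠ 0 ∧ ∀ q : Pt, eval q.coord N ≠ 0 → proj q ∈ V :=
  exists_eval_ne_zero_subset (isOpen_coinduced.1 hV) p hp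

/-- The locus in `𝔹₃` where a homogeneous polynomial does not vanish. -/
def basicOpen (F : Poly) : Set B3 := proj '' {p | eval p.coord F ≠ 0}

theorem proj_mem_basicOpen {F : Poly} {w : Fin 4 → ℤ} (hF : IsWeightedHomogeneous weight F w)
    {p : Pt} : proj p ∈ basicOpen F ↔ eval p.coord F ≠ 0 := by
  refine ⟨?_, fun h => ⟨p, h, rfl⟩⟩
  rintro ⟨q, hq, hqp⟩
  obtain ⟨g, rfl⟩ := exists_smul_of_proj_eq hqp
  rw [Set.mem_ofPred_eq, eval_smul hF] at hq
  exact right_ne_zero_of_mul hq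

theorem isOpen_basicOpen {F : Poly} {w : Fin 4 → ℤ} (hF : IsWeightedHomogeneous weight F w) :
    IsOpen (basicOpen F) :=
  isOpen_coinduced.2 <| TopologicalSpace.isOpen_generateFrom_of_mem
    ⟨F, Set.ext fun _ => proj_mem_basicOpen hF⟩

end Topology

section RegularFunctions

/-- The function on `𝔹₃` given by the values of `φ` on representatives; it is meaningful where `φ`
is invariant under the torus. -/
noncomputable def descend (φ : Pt → ℂ) (x : B3) : ℂ :=
  φ (Function.surjInv proj_surjective x)

theorem descend_proj {φ : Pt → ℂ} {p : Pt} (h : ∀ g : Torus, φ (g • p) = φ p) :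
    descend φ (proj p) = φ p := by
  obtain ⟨g, hg⟩ := exists_smul_of_proj_eq (Function.surjInv_eq proj_surjective (proj p))
  rw [descend, hg, h]

/-- The function `F / G` on `𝔹₃`, for homogeneous polynomials `F` and `G` of the same weight. -/
noncomputable def ratio (F G : Poly) : B3 → ℂ :=
  descend fun q => eval q.coord F / eval q.coord G

theorem ratio_proj {F G : Poly} {w : Fin 4 → ℤ} (hF : IsWeightedHomogeneous weight F w)
    (hG : IsWeightedHomogeneous weight G w) (p : Pt) :
    ratio F G (proj p) = eval p.coord F / eval p.coord G :=
  descend_proj fun g => by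
    rw [eval_smul hF, eval_smul hG, mul_div_mul_left _ _ (Units.ne_zero _)]

theorem isRegularOn_of_eq_div {V : Set B3} {f : B3 → ℂ} (A B : Poly)
    (h : ∀ p, proj p ∈ V → eval p.coord B ≠ 0 ∧ f (proj p) = eval p.coord A / eval p.coord B) :
    IsRegularOn V f :=
  fun p hp => ⟨A, B, (h p hp).1, fun q hq _ => (h q hq).2⟩

theorem isRegularOn_ratio {V : Set B3} {F G : Poly} {w : Fin 4 → ℤ}
    (hF : IsWeightedHomogeneous weight F w) (hG : IsWeightedHomogeneous weight G w)
    (h : ∀ p, proj p ∈ V → eval p.coord G ≠ 0) : IsRegularOn V (ratio F G) :=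
  isRegularOn_of_eq_div F G fun p hp => ⟨h p hp, ratio_proj hF hG p⟩

theorem IsRegularOn.exists_isRelPrime_eq_div {V : Set B3} (hV : IsOpen V) {f : B3 → ℂ}
    (hf : IsRegularOn V f) : ∃ A B : Poly, IsRelPrime A B ∧ ∀ p, proj p ∈ V →
      eval p.coord B ≠ 0 ∧ f (proj p) = eval p.coord A / eval p.coord B := by
  obtain ⟨A, B, hrel, hAB⟩ := isZariskiDense_coord.exists_isRelPrime_fraction (proj ⁻¹' V)
    (f ∘ proj) one_ne_zero fun p hp => by
      obtain ⟨F, G, hG, hFG⟩ := hf p hp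
      obtain ⟨N, hN, hNV⟩ := exists_eval_ne_zero_subset_proj hV hp
      refine ⟨F * N, G * N, by simp [hG, hN], fun q hq _ => ?_⟩
      rw [map_mul, mul_ne_zero_iff] at hq
      rw [Function.comp_apply, hFG q (hNV q hq.2) hq.1, map_mul, map_mul,
        mul_div_mul_right _ _ hq.2]
  exact ⟨A, B, hrel, fun p hp => ⟨(hAB p hp).1, (hAB p hp).2 (by simp)⟩⟩

/-- Invariance of the reduced fraction `A / B` under the torus makes `B` divide its pullbacks, so
that the torus can only rescale `B` by constants. -/
theorem IsRegularOn.exists_isWeightedHomogeneous_eq_div {V : Set B3} (hV : IsOpen V) {f : B3 → ℂ}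
    (hf : IsRegularOn V f) : ∃ (A B : Poly) (w : Fin 4 → ℤ),
      IsWeightedHomogeneous weight A w ∧ IsWeightedHomogeneous weight B w ∧ ∀ p, proj p ∈ V →
        eval p.coord B ≠ 0 ∧ f (proj p) = eval p.coord A / eval p.coord B := by
  rcases V.eq_empty_or_nonempty with rfl | ⟨x, hx⟩
  · exact ⟨0, 0, 0, isWeightedHomogeneous_zero _ _ _, isWeightedHomogeneous_zero _ _ _, by simp⟩
  obtain ⟨p, rfl⟩ := proj_surjective x
  obtain ⟨A, B, hrel, hAB⟩ := hf.exists_isRelPrime_eq_div hV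
  obtain ⟨N, hN, hNV⟩ := exists_eval_ne_zero_subset_proj hV hx
  have hcross (g : Torus) : rescale (diagonal g) A * B = A * rescale (diagonal g) B := by
    refine isZariskiDense_coord.eq_of_eval_eq (ne_zero_of_eval_ne_zero hN) fun q hq => ?_
    obtain ⟨hBq, hfq⟩ := hAB q (hNV q hq)
    obtain ⟨hBgq, hfgq⟩ := hAB (g • q) (by rw [proj_smul]; exact hNV q hq)
    rw [proj_smul, hfq, eq_comm, div_eq_div_iff hBgq hBq] at hfgq
    simpa only [map_mul, eval_rescale, coord_smul] using hfgq
  obtain ⟨w, hB⟩ := exists_isWeightedHomogeneous_of_dvd_rescale fun g =>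
    hrel.symm.dvd_of_dvd_mul_left (hcross g ▸ dvd_mul_left B _)
  refine ⟨A, B, w, isWeightedHomogeneous_iff_rescale.2 fun g => ?_, hB, hAB⟩
  refine mul_right_cancel₀ (ne_zero_of_eval_ne_zero (hAB p hx).1) ?_
  rw [hcross, isWeightedHomogeneous_iff_rescale.1 hB, mul_left_comm, mul_assoc]

end RegularFunctions

section Trivialization

/-- The maximal cones of the fan of `𝔹₃`. Each of them is recorded by the four coordinates that do
not vanish at the corresponding fixed point of the torus. -/
def maximalCones : Finset (Fin 4 → Fin 6) :=
  {![1, 2, 4, 5], ![1, 2, 3, 4], ![0, 2, 3, 5], ![0, 2, 3, 4], ![0, 1, 4, 5], ![0, 1, 3, 5]}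

theorem isUnit_det_weight {σ : Fin 4 → Fin 6} (hσ : σ ∈ maximalCones) :
    IsUnit (Matrix.of fun k => weight (σ k)).det := by
  simp only [maximalCones, Finset.mem_insert, Finset.mem_singleton] at hσ
  rcases hσ with rfl | rfl | rfl | rfl | rfl | rfl <;>
    simp [Matrix.det_succ_row_zero, Fin.sum_univ_succ, Fin.succAbove, weight]

theorem exists_mem_maximalCones (p : Pt) : ∃ σ ∈ maximalCones, ∀ k, p.coord (σ k) ≠ 0 := by
  have hp : ∀ ij ∈ irrelevantPairs, p.coord ij.1 = 0 → p.coord ij.2 ≠ 0 := fun ij hij hi hj =>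
    p.not_mem ⟨ij, hij, hi, hj⟩
  simp only [irrelevantPairs, Finset.mem_insert, Finset.mem_singleton, forall_eq_or_imp,
    forall_eq] at hp
  simp only [maximalCones, Finset.mem_insert, Finset.mem_singleton, exists_eq_or_imp,
    ↓existsAndEq, true_and, Fin.forall_fin_succ, IsEmpty.forall_iff, and_true, Fin.succ_zero_eq_one,
    Fin.succ_one_eq_two, Fin.reduceSucc, Matrix.cons_val_zero, Matrix.cons_val_one, Matrix.cons_val]
  grind

theorem exists_nonvanishing_fraction (p : Pt) (w : Fin 4 → ℤ) : ∃ (P Q : Poly) (v : Fin 4 → ℤ),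
    IsWeightedHomogeneous weight P v ∧ IsWeightedHomogeneous weight Q (w + v) ∧
      eval p.coord P ≠ 0 ∧ eval p.coord Q ≠ 0 := by
  obtain ⟨σ, hcone, hσ⟩ := exists_mem_maximalCones p
  let M : Matrix (Fin 4) (Fin 4) ℤ := Matrix.of fun k => weight (σ k)
  have hw : ∑ k, Matrix.vecMul w M⁻¹ k • weight (σ k) = w := calc
    _ = Matrix.vecMul (Matrix.vecMul w M⁻¹) M := (Matrix.vecMul_eq_sum _ _).symm
    _ = w := by
      rw [Matrix.vecMul_vecMul, Matrix.nonsing_inv_mul M (isUnit_det_weight hcone),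
        Matrix.vecMul_one]
  obtain ⟨P, Q, v, hP, hQ, h⟩ := exists_fraction_eq_prod_zpow (K := ℂ) (w := weight)
    (A := fun _ => 1) (B := fun k => X (σ k)) (u := 0) (v := fun k => weight (σ k))
    (fun _ => isWeightedHomogeneous_one ℂ weight)
    (fun k => by simpa using isWeightedHomogeneous_X ℂ weight (σ k)) (Matrix.vecMul w M⁻¹)
  obtain ⟨hPp, hQp, -⟩ := h p.coord fun k => by simpa using hσ k
  exact ⟨P, Q, v, hP, hw ▸ hQ, hPp, hQp⟩

end Trivialization

section Curves

theorem Curve.isWeightedHomogeneous_equation (C : Curve) :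
    IsWeightedHomogeneous weight C.equation C.cls := by
  have hX (i : Fin 6) : IsWeightedHomogeneous weight (X i : Poly) (weight i) :=
    isWeightedHomogeneous_X ℂ weight i
  cases C with
  | H =>
    have hXXX (i j k : Fin 6) (h : weight i + weight j + weight k = Curve.H.cls) :
        IsWeightedHomogeneous weight (X i * X j * X k : Poly) Curve.H.cls :=
      h ▸ ((hX i).mul (hX j)).mul (hX k)
    exact ((hXXX 0 3 5 (by decide)).add (hXXX 1 4 5 (by decide))).add (hXXX 2 3 4 (by decide))
  | E1 => exact hX 4
  | E2 => exact hX 3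
  | E3 => exact hX 5
  | L1 => exact hX 0
  | L2 => exact hX 1
  | L3 => exact hX 2

theorem irreducible_equation_H : Irreducible Curve.H.equation := by
  set R : Poly := X 1 * X 4 * X 5 + X 2 * X 3 * X 4 with hR
  have hlinear : Curve.H.equation = X 3 * X 5 * X 0 + R := by
    rw [Curve.equation, hR]
    ring
  have hvars : 0 ∉ R.vars := fun h => by
    have hmon (i j k : Fin 6) (h : 0 ∈ (X i * X j * X k : Poly).vars) : 0 = i ∨ 0 = j ∨ 0 = k := by
      have hsub := (vars_mul (X i * X j) (X k)).trans
        (Finset.union_subset_union_left (vars_mul (X i : Poly) (X j)))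
      simpa [vars_X, or_assoc] using hsub h
    rcases Finset.mem_union.1 (vars_add_subset _ _ h) with h | h <;>
      simpa using hmon _ _ _ h
  have hrel (i : Fin 6) (x : Fin 6 → ℂ) (hi : x i = 0) (hx : eval x R ≠ 0) :
      IsRelPrime (X i) R := by
    refine (X_prime.irreducible.isRelPrime_iff_not_dvd).2 fun hdvd => hx ?_
    simpa [hi] using map_dvd (eval x) hdvd
  rw [hlinear]
  refine irreducible_mul_X_add _ _ 0 (mul_ne_zero (X_ne_zero _) (X_ne_zero _)) ?_ hvars
    (.mul_left (hrel 3 ![0, 1, 1, 0, 1, 1] rfl ?_) (hrel 5 ![0, 1, 1, 1, 1, 0] rfl ?_))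
  · intro h
    simpa [vars_X] using vars_mul _ _ h
  all_goals simp [hR]

theorem Curve.prime_equation (C : Curve) : Prime C.equation := by
  cases C with
  | H => exact irreducible_equation_H.prime
  | _ => exact X_prime

theorem Curve.equation_ne_zero (C : Curve) : C.equation ≠ 0 := C.prime_equation.ne_zero

theorem Curve.proj_mem_carrier {C : Curve} {p : Pt} :
    proj p ∈ C.carrier ↔ eval p.coord C.equation = 0 := by
  refine ⟨?_, fun h => ⟨p, rfl, h⟩⟩
  rintro ⟨q, hqp, hq⟩
  obtain ⟨g, rfl⟩ := exists_smul_of_proj_eq hqp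
  rw [eval_smul C.isWeightedHomogeneous_equation] at hq
  exact (mul_eq_zero.1 hq).resolve_left (Units.ne_zero _)

theorem proj_mem_offCurves {p : Pt} :
    proj p ∈ offCurves ↔ ∀ C : Curve, eval p.coord C.equation ≠ 0 :=
  forall_congr' fun _ => not_congr Curve.proj_mem_carrier

theorem exists_eval_ne_zero_not_mem_irrelevantLocus (p : Pt) : ∃ R : Poly,
    eval p.coord R ≠ 0 ∧ ∀ x, eval x R ≠ 0 → x ∉ irrelevantLocus := by
  classical
  refine ⟨∏ i with p.coord i ≠ 0, X i, by simp [Finset.prod_ne_zero_iff], fun x hx => ?_⟩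
  have hzero (i : Fin 6) (hi : x i = 0) : p.coord i = 0 := by
    by_contra hne
    rw [map_prod, Finset.prod_ne_zero_iff] at hx
    exact hx i (by simpa using hne) (by rwa [eval_X])
  rintro ⟨ij, hij, hi, hj⟩
  exact p.not_mem ⟨ij, hij, hzero _ hi, hzero _ hj⟩

theorem dvd_of_forall_eval_coord_eq_zero {P A N : Poly} (hP : Prime P) {p : Pt}
    (hpP : eval p.coord P = 0) (hpN : eval p.coord N ≠ 0)
    (h : ∀ q : Pt, eval q.coord N ≠ 0 → eval q.coord P = 0 → eval q.coord A = 0) : P ∣ A := by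
  obtain ⟨R, hpR, hR⟩ := exists_eval_ne_zero_not_mem_irrelevantLocus p
  have hdvd : P ∣ N * R * A := dvd_of_forall_eval_eq_zero hP fun x hx => by
    by_cases hNR : eval x (N * R) = 0
    · rw [map_mul, hNR, zero_mul]
    · rw [map_mul, mul_eq_zero, not_or] at hNR
      rw [map_mul, h ⟨x, hR x hNR.2⟩ hNR.1 hx, mul_zero]
  refine (hP.dvd_or_dvd hdvd).resolve_left fun hNR => mul_ne_zero hpN hpR ?_
  rw [← map_mul]
  exact zero_dvd_iff.1 (hpP ▸ map_dvd (eval p.coord) hNR)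

end Curves

section LocalEquations

theorem IsRegularOn.exists_eq_equation_mul {C : Curve} {V : Set B3} (hV : IsOpen V) {f : B3 → ℂ}
    (hf : IsRegularOn V f) (hfC : ∀ x ∈ V ∩ C.carrier, f x = 0) {p : Pt} (hp : proj p ∈ V) :
    ∃ (K B : Poly) (w : Fin 4 → ℤ), IsWeightedHomogeneous weight K w ∧
      IsWeightedHomogeneous weight B (C.cls + w) ∧ eval p.coord B ≠ 0 ∧
      ∀ q, proj q ∈ V → eval q.coord B ≠ 0 → f (proj q) =
        eval q.coord C.equation * (eval q.coord K / eval q.coord B) := by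
  obtain ⟨A, B, w, hA, hB, hAB⟩ := hf.exists_isWeightedHomogeneous_eq_div hV
  by_cases hpC : eval p.coord C.equation = 0
  · obtain ⟨N, hpN, hNV⟩ := exists_eval_ne_zero_subset_proj hV hp
    obtain ⟨K, rfl⟩ : C.equation ∣ A :=
      dvd_of_forall_eval_coord_eq_zero C.prime_equation hpC hpN fun q hqN hqC => by
        obtain ⟨hBq, hfq⟩ := hAB q (hNV q hqN)
        rw [hfC _ ⟨hNV q hqN, Curve.proj_mem_carrier.2 hqC⟩, eq_comm, div_eq_zero_iff] at hfq
        exact hfq.resolve_right hBq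
    rw [← add_sub_cancel C.cls w] at hA hB
    refine ⟨K, B, w - C.cls, isWeightedHomogeneous_of_mul_left C.equation_ne_zero
      C.isWeightedHomogeneous_equation hA, hB, (hAB p hp).1, fun q hq _ => ?_⟩
    rw [(hAB q hq).2, map_mul, mul_div_assoc]
  · refine ⟨A, C.equation * B, w, hA, C.isWeightedHomogeneous_equation.mul hB, ?_,
      fun q hq hne => ?_⟩
    · rw [map_mul]
      exact mul_ne_zero hpC (hAB p hp).1
    · rw [map_mul] at hne ⊢
      rw [(hAB q hq).2, ← mul_div_assoc, mul_div_mul_left _ _ (left_ne_zero_of_mul hne)]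

theorem isLocalEquation_ratio {C : Curve} {V : Set B3} (hV : IsOpen V) {P Q : Poly}
    {v : Fin 4 → ℤ} (hP : IsWeightedHomogeneous weight P v)
    (hQ : IsWeightedHomogeneous weight Q (C.cls + v))
    (hne : ∀ p, proj p ∈ V → eval p.coord P ≠ 0 ∧ eval p.coord Q ≠ 0) :
    IsLocalEquation V C (ratio (C.equation * P) Q) := by
  have hCP := C.isWeightedHomogeneous_equation.mul hP
  refine ⟨isRegularOn_ratio hCP hQ fun p hp => (hne p hp).2, ?_, ?_⟩
  · rintro x ⟨-, p, rfl, hp⟩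
    rw [ratio_proj hCP hQ, map_mul, hp, zero_mul, zero_div]
  intro x hx V' hV' hxV' f hf hfC
  obtain ⟨p, rfl⟩ := proj_surjective x
  obtain ⟨K, B, w, hK, hB, hpB, hfB⟩ := hf.exists_eq_equation_mul hV' hfC hxV'
  have hKQ : IsWeightedHomogeneous weight (K * Q) (C.cls + w + v) := by
    convert hK.mul hQ using 1
    abel
  have hBP := hB.mul hP
  refine ⟨V ∩ V' ∩ basicOpen B, (hV.inter hV').inter (isOpen_basicOpen hB),
    ⟨⟨hx, hxV'⟩, (proj_mem_basicOpen hB).2 hpB⟩, Set.inter_subset_left, ratio (K * Q) (B * P),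
    isRegularOn_ratio hKQ hBP fun q hq => ?_, fun y hy => ?_⟩
  · rw [map_mul]
    exact mul_ne_zero ((proj_mem_basicOpen hB).1 hq.2) (hne q hq.1.1).1
  · obtain ⟨q, rfl⟩ := proj_surjective y
    have hBq := (proj_mem_basicOpen hB).1 hy.2
    obtain ⟨hPq, hQq⟩ := hne q hy.1.1
    rw [hfB q hy.1.2 hBq, ratio_proj hCP hQ, ratio_proj hKQ hBP]
    simp only [map_mul]
    field_simp

/-- The local equation is compared with the standard one `C.equation * P / Q`, a multiple of it. -/
theorem IsLocalEquation.exists_eq_equation_mul {C : Curve} {V : Set B3} (hV : IsOpen V)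
    {g : B3 → ℂ} (hg : IsLocalEquation V C g) {p : Pt} (hp : proj p ∈ V) :
    ∃ (A B : Poly) (w : Fin 4 → ℤ), IsWeightedHomogeneous weight A w ∧
      IsWeightedHomogeneous weight B (C.cls + w) ∧ eval p.coord A ≠ 0 ∧ eval p.coord B ≠ 0 ∧
      ∀ q, proj q ∈ V → eval q.coord B ≠ 0 → g (proj q) =
        eval q.coord C.equation * (eval q.coord A / eval q.coord B) := by
  obtain ⟨A, B, w, hA, hB, hpB, hgB⟩ := hg.1.exists_eq_equation_mul hV hg.2.1 hp
  refine ⟨A, B, w, hA, hB, fun hpA => ?_, hpB, hgB⟩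
  obtain ⟨P, Q, v, hP, hQ, hpP, hpQ⟩ := exists_nonvanishing_fraction p C.cls
  have hPQ := hP.mul hQ
  have hU : ∀ q, proj q ∈ basicOpen (P * Q) → eval q.coord P ≠ 0 ∧ eval q.coord Q ≠ 0 :=
    fun q hq => by rwa [proj_mem_basicOpen hPQ, map_mul, mul_ne_zero_iff] at hq
  have hpU : proj p ∈ basicOpen (P * Q) :=
    (proj_mem_basicOpen hPQ).2 (by rw [map_mul]; exact mul_ne_zero hpP hpQ)
  obtain ⟨hreg, hvan, -⟩ := isLocalEquation_ratio (isOpen_basicOpen hPQ) hP hQ hU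
  obtain ⟨V', hV', hpV', hsub, k, hk, hgk⟩ :=
    hg.2.2 _ hp _ (isOpen_basicOpen hPQ) hpU _ hreg hvan
  obtain ⟨F, G, -, hFG⟩ := hk.exists_isRelPrime_eq_div hV'
  obtain ⟨N, hpN, hNV'⟩ := exists_eval_ne_zero_subset_proj hV' hpV'
  have hcross : P * B * G = A * F * Q := by
    refine isZariskiDense_coord.eq_of_eval_eq (N := C.equation * B * N)
      (mul_ne_zero (mul_ne_zero C.equation_ne_zero (ne_zero_of_eval_ne_zero hpB))
        (ne_zero_of_eval_ne_zero hpN)) fun q hq => ?_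
    simp only [map_mul, mul_ne_zero_iff] at hq ⊢
    obtain ⟨⟨hqC, hqB⟩, hqN⟩ := hq
    obtain ⟨hqV, hqU⟩ := hsub (hNV' q hqN)
    obtain ⟨hqG, hkq⟩ := hFG q (hNV' q hqN)
    have hqQ := (hU q hqU).2
    have hgkq := hgk _ (hNV' q hqN)
    rw [ratio_proj (C.isWeightedHomogeneous_equation.mul hP) hQ, hgB q hqV hqB, hkq,
      map_mul] at hgkq
    field_simp at hgkq
    linear_combination hgkq
  have hpG := (hFG p hpV').1
  have hcrossp := congrArg (eval p.coord) hcross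
  simp only [map_mul, hpA, zero_mul] at hcrossp
  exact mul_ne_zero (mul_ne_zero hpP hpB) hpG hcrossp

end LocalEquations

section Sections

theorem exists_isLocalEquation (p : Pt) : ∃ (V : Set B3) (g : Curve → B3 → ℂ),
    IsOpen V ∧ proj p ∈ V ∧ ∀ C, IsLocalEquation V C (g C) := by
  choose P Q v hP hQ hpP hpQ using fun C : Curve => exists_nonvanishing_fraction p C.cls
  have hPQ := IsWeightedHomogeneous.prod Finset.univ _ _ fun C _ => (hP C).mul (hQ C)
  refine ⟨basicOpen (∏ C, P C * Q C), fun C => ratio (C.equation * P C) (Q C),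
    isOpen_basicOpen hPQ, ?_, fun C => ?_⟩
  · rw [proj_mem_basicOpen hPQ, map_prod, Finset.prod_ne_zero_iff]
    exact fun C _ => by simp [hpP, hpQ]
  · refine isLocalEquation_ratio (isOpen_basicOpen hPQ) (hP C) (hQ C) fun q hq => ?_
    rw [proj_mem_basicOpen hPQ, map_prod, Finset.prod_ne_zero_iff] at hq
    simpa using hq C (Finset.mem_univ C)

/-- The value at `q` of the equation of a divisor, the product of the equations of the curves with
their multiplicities. -/
noncomputable def Divisor.evalEquation (D : Divisor) (q : Pt) : ℂ :=
  ∏ C, eval q.coord C.equation ^ D C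

theorem Divisor.evalEquation_smul (D : Divisor) (g : Torus) (q : Pt) :
    D.evalEquation (g • q) = character D.cls g * D.evalEquation q := by
  simp only [Divisor.cls, character_sum, Divisor.evalEquation, Units.coe_prod,
    Units.val_zpow_eq_zpow_val, ← Finset.prod_mul_distrib, ← mul_zpow,
    eval_smul (Curve.isWeightedHomogeneous_equation _)]

theorem Divisor.evalEquation_ne_zero (D : Divisor) {q : Pt} (hq : proj q ∈ offCurves) :
    D.evalEquation q ≠ 0 :=
  Finset.prod_ne_zero_iff.2 fun C _ => zpow_ne_zero _ (proj_mem_offCurves.1 hq C)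

theorem exists_prod_localEquation_eq (D : Divisor) {V : Set B3} (hV : IsOpen V)
    {g : Curve → B3 → ℂ} (hg : ∀ C, IsLocalEquation V C (g C)) {p : Pt} (hp : proj p ∈ V) :
    ∃ (V' : Set B3) (P Q : Poly) (m : Fin 4 → ℤ), IsOpen V' ∧ proj p ∈ V' ∧ V' ⊆ V ∧
      IsWeightedHomogeneous weight P m ∧ IsWeightedHomogeneous weight Q (D.cls + m) ∧
      ∀ q, proj q ∈ V' → eval q.coord P ≠ 0 ∧ eval q.coord Q ≠ 0 ∧
        ∏ C, g C (proj q) ^ D C = D.evalEquation q * (eval q.coord P / eval q.coord Q) := by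
  choose A B w hA hB hpA hpB hgAB using fun C => (hg C).exists_eq_equation_mul hV hp
  have hAB := IsWeightedHomogeneous.prod Finset.univ _ _ fun C _ => (hA C).mul (hB C)
  obtain ⟨P, Q, m, hP, hQ, hPQ⟩ := exists_fraction_eq_prod_zpow hA hB D
  refine ⟨V ∩ basicOpen (∏ C, A C * B C), P, Q, m, hV.inter (isOpen_basicOpen hAB), ⟨hp, ?_⟩,
    Set.inter_subset_left, hP, hQ, fun q ⟨hqV, hq⟩ => ?_⟩
  · rw [proj_mem_basicOpen hAB, map_prod, Finset.prod_ne_zero_iff]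
    exact fun C _ => by simp [hpA, hpB]
  · rw [proj_mem_basicOpen hAB, map_prod, Finset.prod_ne_zero_iff] at hq
    have hne (C : Curve) : eval q.coord (A C) ≠ 0 ∧ eval q.coord (B C) ≠ 0 := by
      simpa using hq C (Finset.mem_univ C)
    obtain ⟨hqP, hqQ, hprod⟩ := hPQ q.coord hne
    refine ⟨hqP, hqQ, ?_⟩
    rw [Divisor.evalEquation, ← hprod, ← Finset.prod_mul_distrib]
    exact Finset.prod_congr rfl fun C _ => by rw [hgAB C q hqV (hne C).2, mul_zpow]

/-- The rational function `F / ∏ C.equation ^ D C` on `𝔹₃`, extended by `0`, as a linear function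
of `F`. It is meaningful when `F` is homogeneous of weight `D.cls`. -/
noncomputable def divEquation (D : Divisor) : Poly →ₗ[ℂ] B3 → ℂ where
  toFun F := offCurves.indicator (descend fun q => eval q.coord F / D.evalEquation q)
  map_add' F G := by
    simp only [map_add, add_div]
    exact Set.indicator_add' _ _ _
  map_smul' c F := by
    simp only [smul_eval, mul_div_assoc, RingHom.id_apply]
    exact Set.indicator_const_smul offCurves c _

theorem divEquation_eq_zero (D : Divisor) (F : Poly) {x : B3} (hx : x ∉ offCurves) :
    divEquation D F x = 0 :=
  Set.indicator_of_notMem hx _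

theorem divEquation_proj {D : Divisor} {F : Poly} (hF : IsWeightedHomogeneous weight F D.cls)
    {q : Pt} (hq : proj q ∈ offCurves) :
    divEquation D F (proj q) = eval q.coord F / D.evalEquation q := by
  refine (Set.indicator_of_mem hq _).trans (descend_proj fun g => ?_)
  rw [eval_smul hF, D.evalEquation_smul, mul_div_mul_left _ _ (Units.ne_zero _)]

theorem isRegularOn_divEquation {D : Divisor} {F : Poly}
    (hF : IsWeightedHomogeneous weight F D.cls) : IsRegularOn offCurves (divEquation D F) := by
  obtain ⟨P, Q, -, -, -, hPQ⟩ := exists_fraction_eq_prod_zpow (A := Curve.equation)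
    (B := fun _ => 1) (v := fun C => -C.cls) Curve.isWeightedHomogeneous_equation
    (fun C => by simpa using isWeightedHomogeneous_one ℂ weight) D
  refine isRegularOn_of_eq_div (F * Q) P fun q hq => ?_
  obtain ⟨hqP, hqQ, hprod⟩ := hPQ q.coord fun C => by simpa using proj_mem_offCurves.1 hq C
  simp only [map_one, div_one] at hprod
  refine ⟨hqP, ?_⟩
  rw [divEquation_proj hF hq, Divisor.evalEquation, hprod, map_mul, div_div_eq_mul_div]

theorem divEquation_mem_sections {D : Divisor} {F : Poly}
    (hF : IsWeightedHomogeneous weight F D.cls) : divEquation D F ∈ sections D := by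
  refine ⟨fun _ => divEquation_eq_zero D F, isRegularOn_divEquation hF, fun V g hV hg x hx => ?_⟩
  obtain ⟨p, rfl⟩ := proj_surjective x
  obtain ⟨V', P, Q, m, hV', hp, hsub, hP, hQ, hPQ⟩ := exists_prod_localEquation_eq D hV hg hx
  have hFP := hF.mul hP
  refine ⟨V', hV', hp, hsub, ratio (F * P) Q,
    isRegularOn_ratio hFP hQ fun q hq => (hPQ q hq).2.1, ?_⟩
  rintro y ⟨hy, hyoff⟩
  obtain ⟨q, rfl⟩ := proj_surjective y
  rw [(hPQ q hy).2.2, divEquation_proj hF hyoff, ratio_proj hFP hQ, map_mul, ← mul_assoc,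
    div_mul_cancel₀ _ (D.evalEquation_ne_zero hyoff), mul_div_assoc]

theorem eval_prod_equation_ne_zero {q : Pt} :
    eval q.coord (∏ C : Curve, C.equation) ≠ 0 ↔ proj q ∈ offCurves := by
  simp [proj_mem_offCurves, Finset.prod_ne_zero_iff]

theorem prod_equation_ne_zero : ∏ C : Curve, C.equation ≠ 0 :=
  Finset.prod_ne_zero_iff.2 fun C _ => C.equation_ne_zero

theorem mul_evalEquation_locally_eq_div {D : Divisor} {f : B3 → ℂ} (hf : f ∈ sections D)
    (p : Pt) : ∃ F G : Poly, eval p.coord G ≠ 0 ∧ ∀ q, eval q.coord G ≠ 0 →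
      proj q ∈ offCurves → f (proj q) * D.evalEquation q = eval q.coord F / eval q.coord G := by
  obtain ⟨V, g, hV, hpV, hg⟩ := exists_isLocalEquation p
  obtain ⟨V₁, P, Q, -, hV₁, hpV₁, -, -, -, hPQ⟩ := exists_prod_localEquation_eq D hV hg hpV
  obtain ⟨V₂, hV₂, hpV₂, -, k, hk, hkf⟩ := hf.2.2 V g hV hg _ hpV
  obtain ⟨F, G, -, hFG⟩ := hk.exists_isRelPrime_eq_div hV₂
  obtain ⟨N, hpN, hN⟩ := exists_eval_ne_zero_subset_proj (hV₁.inter hV₂) ⟨hpV₁, hpV₂⟩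
  refine ⟨F * Q * N, G * P * N, ?_, fun q hq hqoff => ?_⟩
  · simp [(hFG p hpV₂).1, (hPQ p hpV₁).1, hpN]
  · simp only [map_mul, mul_ne_zero_iff] at hq ⊢
    obtain ⟨hqV₁, hqV₂⟩ := hN q hq.2
    obtain ⟨hqP, hqQ, hprod⟩ := hPQ q hqV₁
    obtain ⟨hqG, hkq⟩ := hFG q hqV₂
    have heq := hkf _ ⟨hqV₂, hqoff⟩
    rw [hkq, hprod] at heq
    have hqN := hq.2
    field_simp at heq ⊢
    linear_combination -heq

theorem exists_eq_ne_of_mem_irrelevantLocus {x : Fin 6 → ℂ} (hx : x ∈ irrelevantLocus) :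
    ∃ i j, i ≠ j ∧ x i = 0 ∧ x j = 0 := by
  obtain ⟨ij, hij, hi, hj⟩ := hx
  exact ⟨ij.1, ij.2, (by decide : ∀ ij ∈ irrelevantPairs, ij.1 ≠ ij.2) ij hij, hi, hj⟩

/-- The denominator of the reduced form of `f * D.evalEquation` vanishes at most on the irrelevant
locus, which has codimension two, so it is constant. -/
theorem exists_eval_eq_mul_evalEquation {D : Divisor} {f : B3 → ℂ} (hf : f ∈ sections D) :
    ∃ F : Poly, ∀ q, proj q ∈ offCurves → eval q.coord F = f (proj q) * D.evalEquation q := by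
  obtain ⟨A, B, -, hAB⟩ := isZariskiDense_coord.exists_isRelPrime_fraction Set.univ
    (fun q => f (proj q) * D.evalEquation q) prod_equation_ne_zero fun p _ => by
      simpa only [eval_prod_equation_ne_zero] using mul_evalEquation_locally_eq_div hf p
  have hB : IsUnit B := isUnit_of_forall_exists_pair_eq_zero fun x hx => by
    by_contra hirr
    exact (hAB ⟨x, mt exists_eq_ne_of_mem_irrelevantLocus hirr⟩ trivial).1 hx
  obtain ⟨b, -, rfl⟩ := isUnit_iff_eq_C_of_isReduced.1 hB
  refine ⟨C b⁻¹ * A, fun q hq => ?_⟩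
  rw [(hAB q trivial).2 (eval_prod_equation_ne_zero.2 hq), map_mul, eval_C, eval_C, div_eq_inv_mul]

theorem exists_divEquation_eq {D : Divisor} {f : B3 → ℂ} (hf : f ∈ sections D) :
    ∃ F, IsWeightedHomogeneous weight F D.cls ∧ divEquation D F = f := by
  obtain ⟨F, hF⟩ := exists_eval_eq_mul_evalEquation hf
  have hhom : IsWeightedHomogeneous weight F D.cls :=
    isWeightedHomogeneous_iff_rescale.2 fun g =>
      isZariskiDense_coord.eq_of_eval_eq prod_equation_ne_zero fun q hq => by
        rw [eval_prod_equation_ne_zero] at hq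
        rw [eval_rescale, ← coord_smul, hF (g • q) (by rwa [proj_smul]), proj_smul,
          D.evalEquation_smul, map_mul, eval_C, hF q hq, mul_left_comm]
  refine ⟨F, hhom, funext fun x => ?_⟩
  by_cases hx : x ∈ offCurves
  · obtain ⟨q, rfl⟩ := proj_surjective x
    rw [divEquation_proj hhom hx, hF q hx, mul_div_cancel_right₀ _ (D.evalEquation_ne_zero hx)]
  · rw [divEquation_eq_zero D F hx, hf.1 x hx]

theorem eq_of_divEquation_eq {D : Divisor} {F G : Poly}
    (hF : IsWeightedHomogeneous weight F D.cls) (hG : IsWeightedHomogeneous weight G D.cls)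
    (h : divEquation D F = divEquation D G) : F = G :=
  isZariskiDense_coord.eq_of_eval_eq prod_equation_ne_zero fun q hq => by
    rw [eval_prod_equation_ne_zero] at hq
    have hval := congrFun h (proj q)
    rwa [divEquation_proj hF hq, divEquation_proj hG hq,
      div_left_inj' (D.evalEquation_ne_zero hq)] at hval

/-- The identification of `H⁰(𝔹₃, O(D))` with the part of weight `D.cls` of the Cox ring. -/
noncomputable def sectionsEquiv (D : Divisor) :
    weightedHomogeneousSubmodule ℂ weight D.cls ≃ₗ[ℂ] sections D :=
  .ofBijective ((divEquation D).restrict fun _ => divEquation_mem_sections)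
    ⟨fun F G h => Subtype.ext (eq_of_divEquation_eq F.2 G.2 (congrArg Subtype.val h)),
      fun f => (exists_divEquation_eq f.2).elim fun F h => ⟨⟨F, h.1⟩, Subtype.ext h.2⟩⟩

theorem h0_eq_card (D : Divisor) :
    h0 D = Nat.card {d : Fin 6 →₀ ℕ | Finsupp.weight weight d = D.cls} := by
  rw [h0, ← (sectionsEquiv D).finrank_eq, weightedHomogeneousSubmodule_eq_finsupp_supported]
  exact Module.finrank_eq_nat_card_basis (basisRestrictSupport ℂ _)

end Sections

end CoxRing

section Counting

open Finset

theorem add_single_mem_finsuppAntidiag {ι : Type*} [DecidableEq ι] {s : Finset ι} {i : ι}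
    (hi : i ∈ s) (n k : ℕ) (y : ι →₀ ℕ) :
    y + Finsupp.single i k ∈ finsuppAntidiag s (n + k) ↔ y ∈ finsuppAntidiag s n := by
  rw [mem_finsuppAntidiag, mem_finsuppAntidiag]
  refine and_congr (by simp [sum_add_distrib, Finsupp.single_apply, hi]) (forall_congr' fun j => ?_)
  rcases eq_or_ne j i with rfl | hj
  · simp [hi]
  · simp [hj.symm]

theorem card_finsuppAntidiag_filter_le_apply {ι : Type*} [DecidableEq ι] {s : Finset ι} {i : ι}
    (hi : i ∈ s) (n k : ℕ) :
    #{x ∈ finsuppAntidiag s (n + k) | k ≤ x i} = #(finsuppAntidiag s n) := by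
  rw [← card_map (s := finsuppAntidiag s n) (addRightEmbedding (Finsupp.single i k))]
  congr 1
  ext x
  rw [mem_filter, mem_map]
  constructor
  · rintro ⟨hx, hk⟩
    obtain ⟨y, rfl⟩ := exists_add_of_le (Finsupp.single_le_iff.2 hk)
    rw [add_comm (Finsupp.single i k)] at hx ⊢
    exact ⟨y, (add_single_mem_finsuppAntidiag hi n k y).1 hx, rfl⟩
  · rintro ⟨y, hy, rfl⟩
    exact ⟨(add_single_mem_finsuppAntidiag hi n k y).2 hy, by simp⟩

theorem card_finsuppAntidiag_fin_three (n : ℕ) :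
    #(finsuppAntidiag (univ : Finset (Fin 3)) n) = (n + 2).choose 2 := by
  rw [card_finsuppAntidiag_nat_eq_choose, card_fin, show 3 + n - 1 = n + 2 by omega,
    Nat.choose_symm_add]

theorem card_filter_lt_apply_add {n m : ℕ} (hm : m ≤ n + 1) (i : Fin 3) :
    #{x ∈ finsuppAntidiag univ n | n < x i + m} = (m + 1).choose 2 := by
  rcases m with _ | m
  · refine card_eq_zero.2 (filter_eq_empty_iff.2 fun x hx => not_lt.2 ?_)
    rw [← (mem_finsuppAntidiag.1 hx).1]
    exact single_le_sum (fun _ _ => Nat.zero_le _) (mem_univ i)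
  · obtain ⟨k, rfl⟩ := Nat.exists_eq_add_of_le (Nat.le_of_succ_le_succ hm)
    rw [← card_finsuppAntidiag_fin_three, ← card_finsuppAntidiag_filter_le_apply (mem_univ i) m k]
    congr! 2
    omega

/-- Three disjoint corners are cut off from the simplex of size `n`. -/
theorem card_filter_apply_add_le {n : ℕ} {m : Fin 3 → ℕ}
    (hm : ∀ i j, i ≠ j → m i + m j ≤ n + 1) :
    #{x ∈ finsuppAntidiag univ n | ∀ i, x i + m i ≤ n} + ∑ i, (m i + 1).choose 2 =
      (n + 2).choose 2 := by
  have hcorner (i : Fin 3) :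
      #{x ∈ finsuppAntidiag univ n | n < x i + m i} = (m i + 1).choose 2 := by
    obtain ⟨j, hj⟩ := exists_ne i
    exact card_filter_lt_apply_add (le_of_add_le_left (hm i j hj.symm)) i
  have hdisj : ((univ : Finset (Fin 3)) : Set (Fin 3)).PairwiseDisjoint
      fun i => {x ∈ finsuppAntidiag (univ : Finset (Fin 3)) n | n < x i + m i} := by
    refine fun i _ j _ hij => disjoint_filter.2 fun x hx hi hj => ?_
    have hxij : x i + x j ≤ n := by
      rw [← sum_pair (f := ⇑x) hij, ← (mem_finsuppAntidiag.1 hx).1]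
      exact sum_le_sum_of_subset (subset_univ _)
    have := hm i j hij
    omega
  rw [← card_finsuppAntidiag_fin_three, ← sum_congr rfl fun i _ => hcorner i, ← card_biUnion hdisj,
    ← card_filter_add_card_filter_not (s := finsuppAntidiag univ n) fun x => ∀ i, x i + m i ≤ n]
  congr 2
  ext x
  simp

theorem weight_eq_iff {d : Fin 6 →₀ ℕ} {n : ℕ} {m : Fin 3 → ℕ} :
    Finsupp.weight weight d = ![(n : ℤ), m 0, m 1, m 2] ↔ d 1 + d 0 + d 2 = n ∧
      d 1 + d 3 + m 0 = n ∧ d 0 + d 4 + m 1 = n ∧ d 2 + d 5 + m 2 = n := by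
  rw [Finsupp.weight_apply, Finsupp.sum_fintype _ _ (by simp), funext_iff]
  simp only [weight, nsmul_eq_mul, Finset.sum_apply, Pi.mul_apply, Pi.natCast_apply,
    Matrix.cons_val', Matrix.cons_val_fin_one, Fin.sum_univ_six, Matrix.cons_val_zero,
    Matrix.cons_val_one, Matrix.cons_val, Fin.forall_fin_succ, Matrix.cons_val_succ,
    IsEmpty.forall_iff, and_true]
  omega

theorem mem_filter_apply_add_le_iff {x : Fin 3 →₀ ℕ} {n : ℕ} {m : Fin 3 → ℕ} :
    x ∈ {x ∈ finsuppAntidiag (univ : Finset (Fin 3)) n | ∀ i, x i + m i ≤ n} ↔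
      x 0 + x 1 + x 2 = n ∧ x 0 + m 0 ≤ n ∧ x 1 + m 1 ≤ n ∧ x 2 + m 2 ≤ n := by
  simp only [mem_filter, mem_finsuppAntidiag, Fin.sum_univ_three, subset_univ, and_true,
    Fin.forall_fin_succ, Fin.succ_zero_eq_one, Fin.succ_one_eq_two, IsEmpty.forall_iff]

/-- The entries of `x` are the exponents of `Y`, `X` and `Z`, in the order of `-E₂`, `-E₁`, `-E₃`;
they determine the other three. -/
theorem card_weight_eq (n : ℕ) (m : Fin 3 → ℕ) :
    Nat.card {d : Fin 6 →₀ ℕ | Finsupp.weight weight d = ![(n : ℤ), m 0, m 1, m 2]} =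
      #{x ∈ finsuppAntidiag univ n | ∀ i, x i + m i ≤ n} := by
  rw [Nat.card_coe_set_eq, ← Set.ncard_coe_finset]
  refine Set.ncard_congr (fun d _ => Finsupp.equivFunOnFinite.symm ![d 1, d 0, d 2])
    (fun d hd => ?_) (fun d e hd he hde => ?_) fun x hx => ?_
  · obtain ⟨hsum, h₁, h₀, h₂⟩ := weight_eq_iff.1 hd
    refine mem_filter_apply_add_le_iff.2 ⟨hsum, ?_, ?_, ?_⟩
    · exact (Nat.add_le_add_right (Nat.le_add_right _ _) _).trans h₁.le
    · exact (Nat.add_le_add_right (Nat.le_add_right _ _) _).trans h₀.le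
    · exact (Nat.add_le_add_right (Nat.le_add_right _ _) _).trans h₂.le
  · have hd' := weight_eq_iff.1 hd
    have he' := weight_eq_iff.1 he
    simp only [EmbeddingLike.apply_eq_iff_eq, Matrix.vecCons_inj, and_true] at hde
    refine Finsupp.ext (Fin.forall_fin_succ.2 ?_)
    grind
  · obtain ⟨hsum, h₁, h₀, h₂⟩ := mem_filter_apply_add_le_iff.1 hx
    refine ⟨Finsupp.equivFunOnFinite.symm
        ![x 1, x 0, x 2, n - m 0 - x 0, n - m 1 - x 1, n - m 2 - x 2], ?_, ?_⟩
    · refine weight_eq_iff.2 ⟨hsum, ?_, ?_, ?_⟩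
      · change x 0 + (n - m 0 - x 0) + m 0 = n
        omega
      · change x 1 + (n - m 1 - x 1) + m 1 = n
        omega
      · change x 2 + (n - m 2 - x 2) + m 2 = n
        omega
    · ext i
      fin_cases i <;> rfl

theorem h0_add_sum_choose {D : Divisor} {n : ℕ} {m : Fin 3 → ℕ}
    (hD : D.cls = ![(n : ℤ), m 0, m 1, m 2]) (hm : ∀ i j, i ≠ j → m i + m j ≤ n + 1) :
    h0 D + ∑ i, (m i + 1).choose 2 = (n + 2).choose 2 := by
  rw [h0_eq_card, hD, card_weight_eq, card_filter_apply_add_le hm]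

end Counting

section Classes

theorem theta_pow_six : theta ^ 6 = 1 := by
  decide

theorem classD_six_add (n : ℕ) : classD (6 + n) = ![3, 1, 1, 1] + classD n := by
  have hsix : (∑ i ∈ Finset.range 6, theta ^ i).mulVec Curve.L1.cls = ![3, 1, 1, 1] := by
    decide
  simp only [classD, Finset.sum_range_add, Matrix.add_mulVec, hsix, pow_add, theta_pow_six,
    one_mul]

theorem classD_six_mul_add (m r : ℕ) :
    classD (6 * m + r) = (m : ℤ) • ![3, 1, 1, 1] + classD r := by
  induction m with
  | zero => simp
  | succ m ih =>
    rw [show 6 * (m + 1) + r = 6 + (6 * m + r) by ring, classD_six_add, ih, Nat.cast_succ,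
      add_smul, one_smul]
    abel

theorem two_mul_h0_add {D : Divisor} {m r a : ℕ} {b : Fin 3 → ℕ}
    (hD : D.cls = classD (6 * m + r)) (hr : classD r = ![(a : ℤ), b 0, b 1, b 2])
    (hb : ∀ i j, i ≠ j → b i + b j ≤ a + 1) :
    2 * h0 D + ∑ i, (m + b i) * (m + b i + 1) = (3 * m + a + 1) * (3 * m + a + 2) := by
  have hcls : D.cls = ![((3 * m + a : ℕ) : ℤ), (m + b 0 : ℕ), (m + b 1 : ℕ), (m + b 2 : ℕ)] := by
    rw [hD, classD_six_mul_add, hr]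
    simp [mul_comm]
  have hchoose (k : ℕ) : k * (k + 1) = 2 * (k + 1).choose 2 := by
    rw [mul_comm k, mul_comm 2, ← Nat.add_one_mul_choose_eq, Nat.choose_one_right]
  simp only [hchoose]
  rw [← Finset.mul_sum, ← mul_add,
    h0_add_sum_choose (m := fun i => m + b i) hcls fun i j hij => by grind [hb i j hij]]

theorem h0_of_cls_eq_classD {D : Divisor} {m r : ℕ} (hr : r ≤ 5)
    (hD : D.cls = classD (6 * m + r)) :
    h0 D = if r = 0 then 3 * m ^ 2 + 3 * m + 1 else (m + 1) * (3 * m + r) := by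
  have hh0 (a b₀ b₁ b₂ : ℕ) (hr : classD r = ![(a : ℤ), b₀, b₁, b₂])
      (hb : ∀ i j, i ≠ j → ![b₀, b₁, b₂] i + ![b₀, b₁, b₂] j ≤ a + 1) :
      2 * h0 D + ((m + b₀) * (m + b₀ + 1) + (m + b₁) * (m + b₁ + 1) + (m + b₂) * (m + b₂ + 1)) =
        (3 * m + a + 1) * (3 * m + a + 2) := by
    have hsum := two_mul_h0_add (b := ![b₀, b₁, b₂]) hD hr hb
    rwa [Fin.sum_univ_three] at hsum
  split_ifs with hr0
  · subst hr0
    linarith [hh0 0 0 0 0 (by decide) (by decide)]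
  interval_cases r
  · exact absurd rfl hr0
  · linarith [hh0 1 1 0 1 (by decide) (by decide)]
  · linarith [hh0 1 1 0 0 (by decide) (by decide)]
  · linarith [hh0 2 1 1 1 (by decide) (by decide)]
  · linarith [hh0 2 1 0 1 (by decide) (by decide)]
  · linarith [hh0 3 2 1 1 (by decide) (by decide)]

end Classes

section HilbertSeries

open PowerSeries

theorem mk_mul_one_sub_X_pow {R : Type*} [CommRing R] {a b : ℕ → R} {k : ℕ}
    (hlt : ∀ n < k, a n = b n) (hadd : ∀ n, a (n + k) = a n + b (n + k)) :
    PowerSeries.mk a * (1 - X ^ k) = PowerSeries.mk b := by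
  ext n
  rw [mul_sub, mul_one, map_sub, coeff_mul_X_pow', coeff_mk]
  split_ifs with hn
  · obtain ⟨n, rfl⟩ := Nat.exists_eq_add_of_le' hn
    rw [hadd, Nat.add_sub_cancel, coeff_mk, coeff_mk, add_sub_cancel_left]
  · rw [sub_zero, coeff_mk, hlt n (not_le.1 hn)]

theorem mk_eq_inv_of_apply_add_three {a : ℕ → ℕ} (h0 : a 0 = 1) (h1 : a 1 = 1) (h2 : a 2 = 2)
    (h : ∀ n, a (n + 3) = a n + ((n + 3) / 2 + 1)) :
    PowerSeries.mk (fun n => (a n : ℚ)) = ((1 - X) * (1 - X ^ 2) * (1 - X ^ 3))⁻¹ := by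
  have hX3 : PowerSeries.mk (fun n => (a n : ℚ)) * (1 - X ^ 3) =
      PowerSeries.mk fun n => ((n / 2 + 1 : ℕ) : ℚ) :=
    mk_mul_one_sub_X_pow (fun n hn => by interval_cases n <;> simp [h0, h1, h2]) fun n => by
      rw [h, Nat.cast_add]
  have hX2 : (PowerSeries.mk fun n => ((n / 2 + 1 : ℕ) : ℚ)) * (1 - X ^ 2) = PowerSeries.mk 1 :=
    mk_mul_one_sub_X_pow (fun n hn => by interval_cases n <;> norm_num) fun n => by
      rw [Nat.add_div_right n two_pos]
      simp
  rw [PowerSeries.eq_inv_iff_mul_eq_one (by simp)]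
  calc PowerSeries.mk (fun n => (a n : ℚ)) * ((1 - X) * (1 - X ^ 2) * (1 - X ^ 3))
    _ = PowerSeries.mk (fun n => (a n : ℚ)) * (1 - X ^ 3) * (1 - X ^ 2) * (1 - X) := by ring
    _ = 1 := by rw [hX3, hX2, PowerSeries.mk_one_mul_one_sub_eq_one]

theorem apply_add_three_of_quasipolynomial {a : ℕ → ℕ} (ha : ∀ m r, r ≤ 5 →
      a (6 * m + r) = if r = 0 then 3 * m ^ 2 + 3 * m + 1 else (m + 1) * (3 * m + r)) (n : ℕ) :
    a (n + 3) = a n + ((n + 3) / 2 + 1) := by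
  obtain ⟨m, r, hr, rfl⟩ : ∃ m r, r < 6 ∧ n = 6 * m + r :=
    ⟨n / 6, n % 6, Nat.mod_lt _ (by norm_num), (Nat.div_add_mod n 6).symm⟩
  have hdiv : (6 * m + r + 3) / 2 = 3 * m + (r + 3) / 2 := by omega
  rw [hdiv, ha m r (by omega)]
  rcases lt_or_ge r 3 with hr3 | hr3
  · rw [add_assoc, ha m (r + 3) (by omega)]
    interval_cases r <;> simp only [Nat.reduceAdd, Nat.reduceEqDiff, ↓reduceIte] <;> ring
  · obtain ⟨s, rfl⟩ := Nat.exists_eq_add_of_le' hr3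
    rw [show 6 * m + (s + 3) + 3 = 6 * (m + 1) + s by ring, ha (m + 1) s (by omega)]
    have : s ≤ 2 := by omega
    interval_cases s <;> simp only [Nat.reduceAdd, Nat.reduceEqDiff, ↓reduceIte] <;> ring

end HilbertSeries

end DelPezzo

/-- `D n` is any divisor supported on the seven curves whose class in `Pic 𝔹₃ = ℤ⁴` is `D_n`. -/
theorem mainTheorem5 (D : ℕ → DelPezzo.Divisor) (hD : ∀ n, (D n).cls = DelPezzo.classD n) :
    (∀ m r : ℕ, r ≤ 5 →
      DelPezzo.h0 (D (6 * m + r)) =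
        if r = 0 then 3 * m ^ 2 + 3 * m + 1 else (m + 1) * (3 * m + r)) ∧
    PowerSeries.mk (fun n => (DelPezzo.h0 (D n) : ℚ)) =
      ((1 - PowerSeries.X) * (1 - PowerSeries.X ^ 2) * (1 - PowerSeries.X ^ 3))⁻¹ := by
  have hh0 (m r : ℕ) (hr : r ≤ 5) := DelPezzo.h0_of_cls_eq_classD hr (hD (6 * m + r))
  refine ⟨hh0, DelPezzo.mk_eq_inv_of_apply_add_three ?_ ?_ ?_ <|
    DelPezzo.apply_add_three_of_quasipolynomial (a := fun n => DelPezzo.h0 (D n)) hh0⟩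
  · simpa using hh0 0 0
  · simpa using hh0 0 1
  · simpa using hh0 0 2
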